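/- Let $(\Lambda,\mathcal E)$ be a finite simple graph (no self-loops, at most one edge between two vertices), let $\beta>0$ and $u\in[0,1]$. Let $\rho_u$ be the law of the Poisson point process on $\mathcal E\times[0,\beta]$ with two kinds of events, ``crosses'' with intensity $u$ and ``double bars'' with intensity $1-u$ (with respect to counting measure on $\mathcal E$ times Lebesgue measure on $[0,\beta]$), crosses and double bars being independent; $\Omega$ is the set of its realizations, i.e. of pairs of finite subsets of $\mathcal E\times[0,\beta]$. For $\omega\in\Omega$, let $\mathcal L(\omega)$ be the set of loops of $\omega$: a loop is a closed trajectory in $\Lambda\times[0,\beta]_{\rm per}$ (the endpoints of $[0,\beta]$ being identified), obtained by starting from a point not in the support of $\omega$ and moving vertically until an event on an edge containing the current vertex is met; at a cross on $\{x,y\}$ one goes across to the other endpoint and continues in the same vertical direction, at a double bar one goes across to the other endpoint and continues in the opposite vertical direction. Loops with the same support are identified, whatever their starting point and orientation. The number of loops is denoted $|\mathcal L(\omega)|$. Let $S\in\frac12\mathbb N$ (with $0 \in \mathbb N$), and $\mathcal H_\Lambda=\bigotimes_{x\in\Lambda}\mathbb C^{2S+1}$, where $\mathbb C^{2S+1}$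 has the orthonormal basis $|a\rangle$, $a\in\{-S,-S+1,\dots,S\}$. For $\{x,y\}\in\mathcal E$, let $T_{xy},Q_{xy},P_{xy}$ be the operators that act on the factors $x,y$ with matrix coefficients $$\langle a,b|T_{xy}|c,d\rangle=\delta_{a,d}\delta_{b,c},\qquad \langle a,b|Q_{xy}|c,d\rangle=\delta_{a,b}\delta_{c,d},\qquad \langle a,b|P_{xy}|c,d\rangle=(-1)^{a-c}\delta_{a,-b}\delta_{c,-d},$$ and as the identity on the other factors. Let $$H^{(u)}_\Lambda=-\sum_{\{x,y\}\in\mathcal E}\bigl(uT_{xy}+(1-u)Q_{xy}-1\bigr),\qquad \tilde H^{(u)}_\Lambda=-\sum_{\{x,y\}\in\mathcal E}\bigl(uT_{xy}+(1-u)P_{xy}-1\bigr).$$ Theorem. The function $\omega\mapsto(2S+1)^{|\mathcal L(\omega)|}$ is $\rho_u$-integrable, and $$\int_\Omega(2S+1)^{|\mathcal L(\omega)|}\,{\rm d}\rho_u(\omega)=\operatorname{Tr}_{\mathcal H_\Lambda}{\rm e}^{-\beta H^{(u)}_\Lambda}\quad\text{for all }S\in\tfrac12\mathbb N .$$ If moreover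 $S\in\mathbb N$, then also $$\int_\Omega(2S+1)^{|\mathcal L(\omega)|}\,{\rm d}\rho_u(\omega)=\operatorname{Tr}_{\mathcal H_\Lambda}{\rm e}^{-\beta\tilde H^{(u)}_\Lambda}.$$ -/

import Mathlib

open MeasureTheory

noncomputable section

namespace RandomLoops

/-! ### Poisson point processes with finite intensity measure -/

/-- Realizations of a point process on `X`: finite subsets of `X`. -/
structure PointSet (X : Type*) where
  points : Finset X

/-- The set of the points of a tuple. -/
def PointSet.ofTuple {X : Type*} {k : ℕ} (p : Fin k → X) : PointSet X :=
  open Classical in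
  ⟨Finset.univ.image p⟩

/-- The measurable structure on finite subsets of `X` inherited from the one of `X`: a set `A` of
finite subsets is measurable iff for every `k` the set of `k`-tuples whose set of points belongs
to `A` is measurable. -/
instance pointSetMeasurableSpace (X : Type*) [MeasurableSpace X] : MeasurableSpace (PointSet X) :=
  ⨅ k : ℕ, MeasurableSpace.map (PointSet.ofTuple (X := X) (k := k)) MeasurableSpace.pi

/-- The law of the Poisson point process on `X` whose intensity is the finite measure `ν` (used
here for diffuse `ν` only): the number of points is Poisson with mean `ν X` and, given that
there are `k` of them, they are independent with law `ν / ν X`. Thus the law is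
the sum over `k` of `exp (-ν X) / k!` times the image of the product measure `ν ^ k`. -/
def poissonProcess {X : Type*} [MeasurableSpace X] (ν : Measure X) : Measure (PointSet X) :=
  Measure.sum fun k : ℕ =>
    ENNReal.ofReal (Real.exp (-ν.real Set.univ) / (k.factorial : ℝ)) •
      Measure.map (PointSet.ofTuple (k := k)) (Measure.pi fun _ => ν)

/-! ### Random loops -/

/-- The two kinds of events. -/
inductive Kind
  | cross
  | bar

instance kindMeasurableSpace : MeasurableSpace Kind := ⊤

/-- The discrete measurable structure on the set of edges. -/
instance edgeMeasurableSpace {V : Type*} (G : SimpleGraph V) : MeasurableSpace G.edgeSet := ⊤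

/-- An event: a cross or a double bar, on an edge and at a time in `[0, β]`. -/
abbrev Link {V : Type*} (G : SimpleGraph V) (β : ℝ) : Type _ :=
  G.edgeSet × Set.Icc (0 : ℝ) β × Kind

/-- The realizations: finite sets of events, that is, a finite set of crosses together with
a finite set of double bars. -/
abbrev Config {V : Type*} (G : SimpleGraph V) (β : ℝ) : Type _ := PointSet (Link G β)

/-- Intensity `u` for the crosses and `1 - u` for the double bars, with respect to the counting
measure on the edges times the Lebesgue measure on `[0, β]`. -/
def intensity {V : Type*} (G : SimpleGraph V) (β u : ℝ) : Measure (Link G β) :=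
  Measure.count.prod ((Measure.comap (Subtype.val : Set.Icc (0 : ℝ) β → ℝ) volume).prod
    (ENNReal.ofReal u • Measure.dirac Kind.cross + ENNReal.ofReal (1 - u) • Measure.dirac Kind.bar))

/-- The law `ρ_u` of the Poisson point process of crosses and double bars. -/
def rho {V : Type*} (G : SimpleGraph V) (β u : ℝ) : Measure (Config G β) :=
  poissonProcess (intensity G β u)

/-- No event of `ω` touches the vertex `x` during the set of times `I`. -/
def Clear {V : Type*} {G : SimpleGraph V} {β : ℝ} (ω : Config G β) (x : V) (I : Set ℝ) : Prop :=
  ∀ l ∈ ω.points, x ∈ (l.1 : Sym2 V) → (l.2.1 : ℝ) ∉ I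

/-- The points of `Λ × [0, β]` that are not in the support of `ω`. -/
def Point {V : Type*} {G : SimpleGraph V} {β : ℝ} (ω : Config G β) : Type _ :=
  {p : V × Set.Icc (0 : ℝ) β // Clear ω p.1 {(p.2 : ℝ)}}

/-- `Piece ω p q`: there is an elementary piece of trajectory between the points `p` and `q`. Since
loops that differ by their orientation are identified, pieces are listed in one orientation. -/
inductive Piece {V : Type*} {G : SimpleGraph V} {β : ℝ} (ω : Config G β) :
    Point ω → Point ω → Prop
  /-- Vertical motion that meets no event. -/
  | vertical (p q : Point ω) (hx : p.1.1 = q.1.1) (hle : (p.1.2 : ℝ) ≤ (q.1.2 : ℝ))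
      (hc : Clear ω p.1.1 (Set.Icc (p.1.2 : ℝ) (q.1.2 : ℝ))) : Piece ω p q
  /-- Time is periodic: `β` is identified with `0`. -/
  | wrap (p q : Point ω) (hx : p.1.1 = q.1.1) (hp : (p.1.2 : ℝ) = β) (hq : (q.1.2 : ℝ) = 0) :
      Piece ω p q
  /-- A cross on the edge `{x, y}` at time `r`: reach it at `x` from below, go across to `y`, and
  continue upwards. -/
  | cross (p q : Point ω) (e : G.edgeSet) (r : Set.Icc (0 : ℝ) β)
      (hl : (e, r, Kind.cross) ∈ ω.points) (he : (e : Sym2 V) = s(p.1.1, q.1.1))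
      (hp : (p.1.2 : ℝ) < (r : ℝ)) (hq : (r : ℝ) < (q.1.2 : ℝ))
      (hpc : Clear ω p.1.1 (Set.Ico (p.1.2 : ℝ) (r : ℝ)))
      (hqc : Clear ω q.1.1 (Set.Ioc (r : ℝ) (q.1.2 : ℝ))) : Piece ω p q
  /-- A double bar on the edge `{x, y}` at time `r`: reach it at `x` from below, go across to `y`,
  and continue downwards. -/
  | barBelow (p q : Point ω) (e : G.edgeSet) (r : Set.Icc (0 : ℝ) β)
      (hl : (e, r, Kind.bar) ∈ ω.points) (he : (e : Sym2 V) = s(p.1.1, q.1.1))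
      (hp : (p.1.2 : ℝ) < (r : ℝ)) (hq : (q.1.2 : ℝ) < (r : ℝ))
      (hpc : Clear ω p.1.1 (Set.Ico (p.1.2 : ℝ) (r : ℝ)))
      (hqc : Clear ω q.1.1 (Set.Ico (q.1.2 : ℝ) (r : ℝ))) : Piece ω p q
  /-- A double bar on the edge `{x, y}` at time `r`: reach it at `x` from above, go across to `y`,
  and continue upwards. -/
  | barAbove (p q : Point ω) (e : G.edgeSet) (r : Set.Icc (0 : ℝ) β)
      (hl : (e, r, Kind.bar) ∈ ω.points) (he : (e : Sym2 V) = s(p.1.1, q.1.1))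
      (hp : (r : ℝ) < (p.1.2 : ℝ)) (hq : (r : ℝ) < (q.1.2 : ℝ))
      (hpc : Clear ω p.1.1 (Set.Ioc (r : ℝ) (p.1.2 : ℝ)))
      (hqc : Clear ω q.1.1 (Set.Ioc (r : ℝ) (q.1.2 : ℝ))) : Piece ω p q

/-- The set of loops of `ω`. Loops are identified when they have the same support, so a loop
is a class of points for the equivalence relation generated by the pieces of trajectories. -/
def Loops {V : Type*} {G : SimpleGraph V} {β : ℝ} (ω : Config G β) : Type _ := Quot (Piece ω)

/-- The number of loops. -/
def numLoops {V : Type*} {G : SimpleGraph V} {β : ℝ} (ω : Config G β) : ℕ := Nat.card (Loops ω)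

/-! ### Quantum spin systems

The spin is `S = n / 2` with `n : ℕ`. The index `i : Fin (n + 1)` stands for the
eigenvalue `i - S` of the third spin operator, the basis of the Hilbert space of a pair of sites is
`|a, b⟩`, and the basis of the Hilbert space of the system is indexed by the
configurations `Λ → Fin (n + 1)`. Operators are given by their matrix coefficients. -/

/-- The eigenvalues `-S, -S + 1, …, S`, where `S = n / 2`. -/
def spinValue {n : ℕ} (i : Fin (n + 1)) : ℚ := (i : ℚ) - (n : ℚ) / 2

/-- Operators on the Hilbert space of a pair of sites. -/
abbrev PairOp (n : ℕ) : Type := Matrix (Fin (n + 1) × Fin (n + 1)) (Fin (n + 1) × Fin (n + 1)) ℂ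

/-- `⟨a, b| T |c, d⟩ = δ_{a,d} δ_{b,c}`. -/
def pairT (n : ℕ) : PairOp n := fun ab cd => if ab.1 = cd.2 ∧ ab.2 = cd.1 then 1 else 0

/-- `⟨a, b| P |c, d⟩ = (-1)^{a-c} δ_{a,-b} δ_{c,-d}`. -/
def pairP (n : ℕ) : PairOp n := fun ab cd =>
  if spinValue ab.1 = -spinValue ab.2 ∧ spinValue cd.1 = -spinValue cd.2 then
    (-1 : ℂ) ^ ((ab.1 : ℤ) - (cd.1 : ℤ)) else 0

/-- `⟨a, b| Q |c, d⟩ = δ_{a,b} δ_{c,d}`. -/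
def pairQ (n : ℕ) : PairOp n := fun ab cd => if ab.1 = ab.2 ∧ cd.1 = cd.2 then 1 else 0

/-- Invariance under the exchange of the two sites. -/
def PairOp.IsSymm {n : ℕ} (A : PairOp n) : Prop := ∀ a b c d, A (a, b) (c, d) = A (b, a) (d, c)

theorem pairT_isSymm (n : ℕ) : (pairT n).IsSymm := by
  intro a b c d
  simp only [pairT, and_comm]

theorem pairQ_isSymm (n : ℕ) : (pairQ n).IsSymm := by
  intro a b c d
  simp only [pairQ, eq_comm]

theorem pairP_isSymm (n : ℕ) : (pairP n).IsSymm := by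
  intro a b c d
  simp only [pairP]
  by_cases h : spinValue a = -spinValue b ∧ spinValue c = -spinValue d
  · have h' : spinValue b = -spinValue a ∧ spinValue d = -spinValue c := by
      constructor <;> linarith [h.1, h.2]
    rw [if_pos h, if_pos h']
    obtain ⟨h1, h2⟩ := h
    simp only [spinValue] at h1 h2
    have h3 : ((b : ℤ) - (d : ℤ)) = -((a : ℤ) - (c : ℤ)) := by
      have : ((b : ℚ) - (d : ℚ)) = -((a : ℚ) - (c : ℚ)) := by linarith
      exact_mod_cast this
    rw [h3, zpow_neg, ← inv_zpow]
    norm_num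
  · have h' : ¬ (spinValue b = -spinValue a ∧ spinValue d = -spinValue c) := by
      rintro ⟨h1, h2⟩
      exact h ⟨by linarith, by linarith⟩
    rw [if_neg h, if_neg h']

/-- Operators on the Hilbert space of the system. -/
abbrev SystemOp (V : Type*) (n : ℕ) : Type _ := Matrix (V → Fin (n + 1)) (V → Fin (n + 1)) ℂ

/-- The extension of an operator on the sites `x, y`, by the tensor product with the
identity on the other sites. -/
def extendOp {V : Type*} [Fintype V] [DecidableEq V] {n : ℕ} (A : PairOp n) (x y : V) :
    SystemOp V n := fun σ τ =>
  if ∀ z, z ≠ x → z ≠ y → σ z = τ z then A (σ x, σ y) (τ x, τ y) else 0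

theorem extendOp_comm {V : Type*} [Fintype V] [DecidableEq V] {n : ℕ} {A : PairOp n}
    (hA : A.IsSymm) (x y : V) : extendOp A x y = extendOp A y x := by
  funext σ τ
  have h : (∀ z, z ≠ x → z ≠ y → σ z = τ z) ↔ (∀ z, z ≠ y → z ≠ x → σ z = τ z) :=
    ⟨fun h z h1 h2 => h z h2 h1, fun h z h1 h2 => h z h2 h1⟩
  simp only [extendOp, h, hA (σ x) (σ y) (τ x) (τ y)]

/-- The operator on the system given by an exchange-invariant pair operator on the edge `{x, y}`. -/
def edgeOp {V : Type*} [Fintype V] [DecidableEq V] {n : ℕ} (A : PairOp n) (hA : A.IsSymm)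
    (e : Sym2 V) : SystemOp V n :=
  Sym2.lift ⟨fun x y => extendOp A x y, extendOp_comm hA⟩ e

/-- `H^{(u)} = - ∑_{{x,y} ∈ E} (u T_{xy} + (1 - u) Q_{xy} - 1)`. -/
def hamiltonian {V : Type*} [Fintype V] [DecidableEq V] (G : SimpleGraph V) [DecidableRel G.Adj]
    (n : ℕ) (u : ℝ) : SystemOp V n :=
  -∑ e ∈ G.edgeFinset, ((u : ℂ) • edgeOp (pairT n) (pairT_isSymm n) e +
    ((1 - u : ℝ) : ℂ) • edgeOp (pairQ n) (pairQ_isSymm n) e - 1)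

/-- `H̃^{(u)} = - ∑_{{x,y} ∈ E} (u T_{xy} + (1 - u) P_{xy} - 1)`. -/
def hamiltonianTilde {V : Type*} [Fintype V] [DecidableEq V] (G : SimpleGraph V)
    [DecidableRel G.Adj] (n : ℕ) (u : ℝ) : SystemOp V n :=
  -∑ e ∈ G.edgeFinset, ((u : ℂ) • edgeOp (pairT n) (pairT_isSymm n) e +
    ((1 - u : ℝ) : ℂ) • edgeOp (pairP n) (pairP_isSymm n) e - 1)

/-- The quantum partition function `Tr exp (-β H)`. -/
def quantumPartition {V : Type*} [Fintype V] [DecidableEq V] {n : ℕ} (β : ℝ)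
    (H : SystemOp V n) : ℂ :=
  Matrix.trace (NormedSpace.exp (-((β : ℂ) • H)))

end RandomLoops

end

/-! The integrand $(2S+1)^{|\mathcal L(\omega)|}$ counts the ways of attaching one of $2S+1$ values
to each loop. Seen along the time axis, such an assignment is a piecewise constant, time-periodic
path of spin configurations: across a cross the two values are exchanged, and at a double bar they
agree at the two sites, just below and just above. These constraints are exactly the nonzero
coefficients, all equal to 1, of $T$ and $Q$. So for events listed in the order of their times, the
integrand is the number of closed paths that contribute to the trace of the product of the event
operators (`Ordered.pow_numLoops`, `markOp_pairQ_apply`).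

The $k$-event part of the Poisson law carries the factor $e^{-\beta|\mathcal E|}/k!$. Almost surely
the times are distinct and interior. Sorting them permutes the marks, which leaves a product of
weights unchanged, so the times contribute only $\beta^k$ (`integral_sortedPaths`). The sum over
marks is $\operatorname{Tr}(\sum(uT+(1-u)Q))^k$ (`trace_totalOp_pow`); summing over $k$ gives the
exponential series, and $e^{-\beta|\mathcal E|}$ comes from the $-1$ in each term of $H$.

For integer $S$ the singlet form is a symmetric involution with a symmetric square root $M$. Then
$M\otimes M$ commutes with $T$ and intertwines $Q$ with $P$ (`kronecker_mul_pairQ`), so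
$\bigotimes_x M$ conjugates $H$ into $\tilde H$ and the traces agree. -/

noncomputable section

namespace RandomLoops

section Combinatorics

variable {V : Type*} {G : SimpleGraph V} {β : ℝ} {k : ℕ}

/-! ### Loops and closed paths of spin configurations -/

/-- The relation between the spin configurations just before and just after an event. -/
def Compat {C : Type*} (m : G.edgeSet × Kind) (p q : V → C) : Prop :=
  (∀ z, z ∉ (m.1 : Sym2 V) → p z = q z) ∧
    (m.2 = Kind.cross → ∀ x y, (m.1 : Sym2 V) = s(x, y) → p x = q y) ∧
    (m.2 = Kind.bar → ∀ x y, (m.1 : Sym2 V) = s(x, y) → p x = p y ∧ q x = q y)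

/-- Time-periodic sequences of spin configurations that are compatible with a sequence of events. -/
def ClosedPath {C : Type*} (m : Fin k → G.edgeSet × Kind) (p : Fin (k + 1) → V → C) : Prop :=
  p 0 = p (Fin.last k) ∧ ∀ i, Compat (m i) (p i.castSucc) (p i.succ)

/-! ### Ordered events and the time slices between them -/

/-- The time of an event. -/
def time (l : Link G β) : ℝ := l.2.1

/-- The edge and the kind of an event. -/
def mark (l : Link G β) : G.edgeSet × Kind := (l.1, l.2.2)

/-- The number of events before the time `t`. -/
def level (s : Fin k → Link G β) (t : ℝ) : Fin (k + 1) :=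
  ⟨(Finset.univ.filter fun i => time (s i) < t).card, by
    have := Finset.card_filter_le (Finset.univ : Finset (Fin k)) (fun i => time (s i) < t)
    simp only [Finset.card_univ, Fintype.card_fin] at this
    omega⟩

/-- The events are listed in the order of their times, which are distinct and in `(0, β)`. -/
structure Ordered (s : Fin k → Link G β) : Prop where
  mono : StrictMono fun i => time (s i)
  pos : ∀ i, 0 < time (s i)
  lt : ∀ i, time (s i) < β

variable {s : Fin k → Link G β}

/-- Since the times increase, the events before `t` form an initial segment, which is determined by
its cardinality. -/
theorem Ordered.time_lt_iff (hs : Ordered s) (i : Fin k) (t : ℝ) :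
    time (s i) < t ↔ i.castSucc < level s t := by
  rw [Fin.lt_def]
  simp only [level, Fin.val_castSucc]
  constructor
  · intro h
    have : (Finset.Iic i).card ≤ (Finset.univ.filter fun i => time (s i) < t).card := by
      apply Finset.card_le_card
      intro j hj
      rw [Finset.mem_Iic] at hj
      simpa using (hs.mono.monotone hj).trans_lt h
    rw [Fin.card_Iic] at this
    omega
  · intro h
    by_contra hn
    have : (Finset.univ.filter fun i => time (s i) < t).card ≤ (Finset.Iio i).card := by
      apply Finset.card_le_card
      intro j hj
      simp only [Finset.mem_filter, Finset.mem_univ, true_and] at hj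
      rw [Finset.mem_Iio]
      by_contra hij
      exact hn ((hs.mono.monotone (not_lt.mp hij)).trans_lt hj)
    rw [Fin.card_Iio] at this
    omega

theorem Ordered.level_eq (hs : Ordered s) {t : ℝ} {j : Fin (k + 1)}
    (h : ∀ i, time (s i) < t ↔ i.castSucc < j) : level s t = j := by
  have h' : ∀ i : Fin k, i.castSucc < level s t ↔ i.castSucc < j := fun i =>
    (hs.time_lt_iff i t).symm.trans (h i)
  rcases lt_trichotomy (level s t) j with hl | hl | hl
  -- The smaller of the two slices, read as an event index, lies below the larger one but not below
  -- itself.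
  · have := (h' ⟨level s t, by omega⟩).2 hl
    exact absurd this (lt_irrefl _)
  · exact hl
  · have := (h' ⟨j, by omega⟩).1 hl
    exact absurd this (lt_irrefl _)

theorem Ordered.level_zero (hs : Ordered s) : level s 0 = 0 :=
  hs.level_eq fun j => by simpa using (hs.pos j).le

theorem Ordered.level_last (hs : Ordered s) : level s β = Fin.last k :=
  hs.level_eq fun j => by simpa [Fin.castSucc_lt_last] using hs.lt j

theorem Ordered.exists_between (hs : Ordered s) (hβ : 0 < β) (j : Fin (k + 1)) :
    ∃ t : Set.Icc (0 : ℝ) β, ∀ i, (i.castSucc < j → time (s i) < t) ∧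
      (¬ i.castSucc < j → (t : ℝ) < time (s i)) := by
  classical
  -- Adding `0` to the lower set and `β` to the upper one keeps the chosen time inside the interval,
  -- also when one side has no event.
  obtain ⟨m, h1, h2⟩ := Order.exists_between_finsets
    (insert 0 ((Finset.univ.filter fun i : Fin k => i.castSucc < j).image fun i => time (s i)))
    (insert β ((Finset.univ.filter fun i : Fin k => ¬ i.castSucc < j).image fun i => time (s i)))
    (by
      intro x hx y hy
      simp only [Finset.mem_insert, Finset.mem_image, Finset.mem_filter, Finset.mem_univ,
        true_and] at hx hy
      rcases hx with rfl | ⟨a, ha, rfl⟩ <;> rcases hy with rfl | ⟨b, hb, rfl⟩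
      · exact hβ
      · exact hs.pos b
      · exact hs.lt a
      · apply hs.mono
        rw [← Fin.castSucc_lt_castSucc_iff]
        exact ha.trans_le (not_lt.mp hb))
  refine ⟨⟨m, (h1 0 (by simp)).le, (h2 β (by simp)).le⟩,
    fun i => ⟨fun hi => h1 _ ?_, fun hi => h2 _ ?_⟩⟩
  · exact Finset.mem_insert_of_mem (Finset.mem_image_of_mem _ (by simpa using hi))
  · exact Finset.mem_insert_of_mem (Finset.mem_image_of_mem _ (by simpa using hi))

theorem mem_ofTuple {X : Type*} {s : Fin k → X} {l : X} :
    l ∈ (PointSet.ofTuple s).points ↔ ∃ i, s i = l := by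
  simp [PointSet.ofTuple]

theorem ofTuple_comp_perm {X : Type*} (t : Fin k → X) (σ : Equiv.Perm (Fin k)) :
    PointSet.ofTuple (t ∘ σ) = PointSet.ofTuple t := by
  simp only [PointSet.ofTuple, PointSet.mk.injEq]
  ext x
  simp only [Finset.mem_image, Finset.mem_univ, true_and]
  exact (σ.surjective.exists (p := fun i => t i = x)).symm

theorem clear_ofTuple_iff {x : V} {I : Set ℝ} :
    Clear (PointSet.ofTuple s) x I ↔ ∀ i, x ∈ ((s i).1 : Sym2 V) → time (s i) ∉ I := by
  simp only [Clear, mem_ofTuple, time]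
  constructor
  · exact fun h i => h _ ⟨i, rfl⟩
  · rintro h _ ⟨i, rfl⟩
    exact h i

/-! ### Functions constant along loops as closed paths -/

/-- Functions that are constant along the loops. -/
def IsInvariant {C : Type*} (ω : Config G β) (c : Point ω → C) : Prop :=
  ∀ p q, Piece ω p q → c p = c q

/-- Functions on the set of loops are functions of points that are constant along the loops. -/
def loopsFunEquiv (C : Type*) (ω : Config G β) :
    (Loops ω → C) ≃ {c : Point ω → C // IsInvariant ω c} where
  toFun f := ⟨fun p => f (Quot.mk _ p), fun _ _ h => congrArg f (Quot.sound h)⟩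
  invFun c := Quot.lift c.1 c.2
  left_inv f := by
    funext x
    induction x using Quot.ind
    rfl
  right_inv c := rfl

theorem Ordered.vertical_of_level_eq {C : Type*} (hs : Ordered s)
    {c : Point (PointSet.ofTuple s) → C} (hc : IsInvariant _ c)
    {p q : Point (PointSet.ofTuple s)} (hx : p.1.1 = q.1.1)
    (hl : level s p.1.2 = level s q.1.2) : c p = c q := by
  wlog hle : (p.1.2 : ℝ) ≤ q.1.2 generalizing p q
  · exact (this hx.symm hl.symm (le_of_not_ge hle)).symm
  refine hc p q (.vertical p q hx hle ?_)
  rw [clear_ofTuple_iff]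
  rintro i hi ⟨h1, h2⟩
  -- `level` counts strictly earlier events, so an event at the very time of `q` would not be
  -- detected; it is excluded because `q` is off the support.
  have hq := clear_ofTuple_iff.1 q.2 i (hx ▸ hi)
  rw [Set.mem_singleton_iff] at hq
  have h3 := (hs.time_lt_iff i _).1 (lt_of_le_of_ne h2 hq)
  rw [← hl] at h3
  exact absurd ((hs.time_lt_iff i _).2 h3) (not_lt.mpr h1)

theorem ClosedPath.eq_of_clear {C : Type*} {p : Fin (k + 1) → V → C}
    (hp : ∀ i, Compat (mark (s i)) (p i.castSucc) (p i.succ)) (x : V) {a b : Fin (k + 1)}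
    (hab : a ≤ b) (h : ∀ i : Fin k, a ≤ i.castSucc → i.castSucc < b → x ∉ ((s i).1 : Sym2 V)) :
    p a x = p b x := by
  induction b using Fin.induction with
  | zero => rw [Fin.le_zero_iff.1 hab]
  | succ i ih =>
    rcases hab.eq_or_lt with rfl | hlt
    · rfl
    · have hai : a ≤ i.castSucc := by
        rw [Fin.le_def]; rw [Fin.lt_def] at hlt; simp at hlt ⊢; omega
      rw [ih hai fun j h1 h2 => h j h1 (h2.trans i.castSucc_lt_succ)]
      exact (hp i).1 x (h i hai i.castSucc_lt_succ)

theorem exists_eq_of_mem {e : G.edgeSet} {r : Set.Icc (0 : ℝ) β}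
    {K : Kind} (h : (e, r, K) ∈ (PointSet.ofTuple s).points) :
    ∃ i, mark (s i) = (e, K) ∧ time (s i) = r := by
  obtain ⟨i, hi⟩ := mem_ofTuple.1 h
  have ht : time (s i) = r := by rw [hi]; rfl
  exact ⟨i, by rw [hi]; rfl, ht⟩

/-- The value before the event `i` of a path at a site that meets no event during `[t, t_i)`. -/
theorem Ordered.path_before {C : Type*} (hs : Ordered s) {p : Fin (k + 1) → V → C}
    (hp : ∀ i, Compat (mark (s i)) (p i.castSucc) (p i.succ)) {x : V} {t : ℝ} {i : Fin k}
    (ht : t < time (s i)) (hc : Clear (PointSet.ofTuple s) x (Set.Ico t (time (s i)))) :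
    p (level s t) x = p i.castSucc x := by
  apply ClosedPath.eq_of_clear hp
  · rw [← not_lt, ← hs.time_lt_iff]
    exact ht.le.not_gt
  · intro j h1 h2 hx
    refine clear_ofTuple_iff.1 hc j hx ⟨?_, hs.mono (Fin.castSucc_lt_castSucc_iff.1 h2)⟩
    rw [← not_lt, hs.time_lt_iff]
    exact not_lt.mpr h1

/-- The value after the event `i` of a path at a site that meets no event during `(t_i, t]`. -/
theorem Ordered.path_after {C : Type*} (hs : Ordered s) {p : Fin (k + 1) → V → C}
    (hp : ∀ i, Compat (mark (s i)) (p i.castSucc) (p i.succ)) {x : V} {t : ℝ} {i : Fin k}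
    (ht : time (s i) < t) (hc : Clear (PointSet.ofTuple s) x (Set.Ioc (time (s i)) t)) :
    p i.succ x = p (level s t) x := by
  apply ClosedPath.eq_of_clear hp
  · have := (hs.time_lt_iff i t).1 ht
    exact this
  · intro j h1 h2 hx
    refine clear_ofTuple_iff.1 hc j hx ⟨hs.mono ?_, ((hs.time_lt_iff j t).2 h2).le⟩
    rw [Fin.lt_def]; rw [Fin.le_def] at h1; simp at h1; omega

/-- Each kind of piece uses one property of the path: vertical motion the constancy off the edge of
an event, wrapping the periodicity, and crosses and bars the corresponding clause of `Compat`. -/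
theorem Ordered.isInvariant_of_closedPath {C : Type*} (hs : Ordered s)
    {p : Fin (k + 1) → V → C} (hp : ClosedPath (fun i => mark (s i)) p) :
    IsInvariant (PointSet.ofTuple s) fun a => p (level s a.1.2) a.1.1 := by
  obtain ⟨hper, hp⟩ := hp
  replace hp : ∀ i, Compat (mark (s i)) (p i.castSucc) (p i.succ) := hp
  intro a b hab
  cases hab with
  | vertical hx hle hc =>
    simp only
    rw [← hx]
    rw [clear_ofTuple_iff] at hc
    apply ClosedPath.eq_of_clear hp
    · by_contra hlt
      rw [not_le] at hlt
      have hi := (hs.time_lt_iff ⟨level s b.1.2, by omega⟩ a.1.2).2 hlt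
      have := (hs.time_lt_iff ⟨level s b.1.2, by omega⟩ b.1.2).1 (hi.trans_le hle)
      exact absurd this (lt_irrefl _)
    · intro j h1 h2 hx
      refine hc j hx ⟨?_, ((hs.time_lt_iff j _).2 h2).le⟩
      rw [← not_lt, hs.time_lt_iff]
      exact not_lt.mpr h1
  | wrap hx ha hb =>
    simp only
    rw [ha, hb, hs.level_zero, hs.level_last, hper, hx]
  | cross e r hl he ha hb hac hbc =>
    obtain ⟨i, hi, hr⟩ := exists_eq_of_mem hl
    rw [← hr] at ha hb hac hbc
    simp only
    rw [hs.path_before hp ha hac, ← hs.path_after hp hb hbc]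
    exact (hp i).2.1 (by rw [hi]) _ _ (by simpa only [hi] using he)
  | barBelow e r hl he ha hb hac hbc =>
    obtain ⟨i, hi, hr⟩ := exists_eq_of_mem hl
    rw [← hr] at ha hb hac hbc
    simp only
    rw [hs.path_before hp ha hac, hs.path_before hp hb hbc]
    exact ((hp i).2.2 (by rw [hi]) _ _ (by simpa only [hi] using he)).1
  | barAbove e r hl he ha hb hac hbc =>
    obtain ⟨i, hi, hr⟩ := exists_eq_of_mem hl
    rw [← hr] at ha hb hac hbc
    simp only
    rw [← hs.path_after hp ha hac, ← hs.path_after hp hb hbc]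
    exact ((hp i).2.2 (by rw [hi]) _ _ (by simpa only [hi] using he)).2

/-- A point at the site `x`, at a time between the events `j - 1` and `j`. -/
def Ordered.midpoint (hs : Ordered s) (hβ : 0 < β) (j : Fin (k + 1)) (x : V) :
    Point (PointSet.ofTuple s) :=
  ⟨(x, (hs.exists_between hβ j).choose), by
    rw [clear_ofTuple_iff]
    intro i _ hi
    have h := (hs.exists_between hβ j).choose_spec i
    by_cases hij : i.castSucc < j
    · exact (h.1 hij).ne hi
    · exact (h.2 hij).ne' hi⟩

theorem Ordered.time_lt_midpoint (hs : Ordered s) (hβ : 0 < β) {j : Fin (k + 1)} {x : V}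
    {i : Fin k} (h : i.castSucc < j) : time (s i) < (hs.midpoint hβ j x).1.2 :=
  ((hs.exists_between hβ j).choose_spec i).1 h

theorem Ordered.midpoint_lt_time (hs : Ordered s) (hβ : 0 < β) {j : Fin (k + 1)} {x : V}
    {i : Fin k} (h : ¬ i.castSucc < j) : ((hs.midpoint hβ j x).1.2 : ℝ) < time (s i) :=
  ((hs.exists_between hβ j).choose_spec i).2 h

theorem Ordered.level_midpoint (hs : Ordered s) (hβ : 0 < β) (j : Fin (k + 1)) (x : V) :
    level s (hs.midpoint hβ j x).1.2 = j :=
  hs.level_eq fun i => by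
    by_cases hij : i.castSucc < j
    · exact iff_of_true (hs.time_lt_midpoint hβ hij) hij
    · exact iff_of_false (hs.midpoint_lt_time hβ hij).not_gt hij

theorem Ordered.clear_before (hs : Ordered s) (hβ : 0 < β) (i : Fin k) (x : V) :
    Clear (PointSet.ofTuple s) x
      (Set.Ico ((hs.midpoint hβ i.castSucc x).1.2 : ℝ) (time (s i))) := by
  rw [clear_ofTuple_iff]
  rintro j - ⟨h1, h2⟩
  exact absurd (hs.time_lt_midpoint hβ (Fin.castSucc_lt_castSucc_iff.2 (hs.mono.lt_iff_lt.1 h2)))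
    (not_lt.mpr h1)

theorem Ordered.clear_after (hs : Ordered s) (hβ : 0 < β) (i : Fin k) (x : V) :
    Clear (PointSet.ofTuple s) x
      (Set.Ioc (time (s i)) ((hs.midpoint hβ i.succ x).1.2 : ℝ)) := by
  rw [clear_ofTuple_iff]
  rintro j - ⟨h1, h2⟩
  refine absurd (hs.midpoint_lt_time hβ (i := j) (j := i.succ) (x := x) ?_) (not_lt.mpr h2)
  have := hs.mono.lt_iff_lt.1 h1
  rw [Fin.lt_def] at this ⊢
  simp
  omega

/-- Sampling at one time per slice suffices: midpoints of consecutive slices are separated by a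
single event, so one elementary piece joins them as `Compat` requires. -/
theorem Ordered.closedPath_of_isInvariant {C : Type*} (hs : Ordered s) (hβ : 0 < β)
    {c : Point (PointSet.ofTuple s) → C} (hc : IsInvariant _ c) :
    ClosedPath (fun i => mark (s i)) fun j x => c (hs.midpoint hβ j x) := by
  have hmem : ∀ i, ((mark (s i)).1, (s i).2.1, (mark (s i)).2) ∈ (PointSet.ofTuple s).points :=
    fun i => mem_ofTuple.2 ⟨i, rfl⟩
  have hlt : ∀ i x, ((hs.midpoint hβ i.castSucc x).1.2 : ℝ) < time (s i) :=
    fun i x => hs.midpoint_lt_time hβ (lt_irrefl _)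
  have hgt : ∀ i x, time (s i) < ((hs.midpoint hβ i.succ x).1.2 : ℝ) :=
    fun i x => hs.time_lt_midpoint hβ i.castSucc_lt_succ
  refine ⟨?_, fun i => ⟨fun z hz => ?_, fun hK x y he => ?_, fun hK x y he => ⟨?_, ?_⟩⟩⟩
  · funext x
    have h0 : Clear (PointSet.ofTuple s) x {(0 : ℝ)} := by
      rw [clear_ofTuple_iff]
      exact fun i _ h => (hs.pos i).ne' h
    have h1 : Clear (PointSet.ofTuple s) x {β} := by
      rw [clear_ofTuple_iff]
      exact fun i _ h => (hs.lt i).ne h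
    -- No event sits at time `0` or `β`, so both ends are genuine points: the first and last slices
    -- are joined vertically to them, and they to each other by wrapping.
    let a : Point (PointSet.ofTuple s) := ⟨(x, ⟨0, le_rfl, hβ.le⟩), h0⟩
    let b : Point (PointSet.ofTuple s) := ⟨(x, ⟨β, hβ.le, le_rfl⟩), h1⟩
    calc c (hs.midpoint hβ 0 x) = c a := by
          refine hs.vertical_of_level_eq hc (by rfl) ?_
          rw [hs.level_midpoint, show ((a.1.2 : Set.Icc (0 : ℝ) β) : ℝ) = 0 from rfl, hs.level_zero]
      _ = c b := (hc b a (.wrap b a rfl rfl rfl)).symm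
      _ = c (hs.midpoint hβ (Fin.last k) x) := by
          refine hs.vertical_of_level_eq hc (by rfl) ?_
          rw [hs.level_midpoint, show ((b.1.2 : Set.Icc (0 : ℝ) β) : ℝ) = β from rfl, hs.level_last]
  · refine hc _ _ (.vertical _ _ rfl ((hlt i z).trans (hgt i z)).le ?_)
    rw [clear_ofTuple_iff]
    rintro j hj ⟨h1, h2⟩
    rcases lt_trichotomy (time (s j)) (time (s i)) with h | h | h
    · exact clear_ofTuple_iff.1 (hs.clear_before hβ i z) j hj ⟨h1, h⟩
    · rw [hs.mono.injective h] at hj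
      exact hz hj
    · exact clear_ofTuple_iff.1 (hs.clear_after hβ i z) j hj ⟨h, h2⟩
  · exact hc _ _ (.cross _ _ _ (s i).2.1 (hK ▸ hmem i) he (hlt i x) (hgt i y)
      (hs.clear_before hβ i x) (hs.clear_after hβ i y))
  · exact hc _ _ (.barBelow _ _ _ (s i).2.1 (hK ▸ hmem i) he (hlt i x) (hlt i y)
      (hs.clear_before hβ i x) (hs.clear_before hβ i y))
  · exact hc _ _ (.barAbove _ _ _ (s i).2.1 (hK ▸ hmem i) he (hgt i x) (hgt i y)
      (hs.clear_after hβ i x) (hs.clear_after hβ i y))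

/-- Functions that are constant along the loops amount to closed paths of spin configurations. -/
def Ordered.invariantEquiv (C : Type*) (hs : Ordered s) (hβ : 0 < β) :
    {c : Point (PointSet.ofTuple s) → C // IsInvariant _ c} ≃
      {p : Fin (k + 1) → V → C // ClosedPath (fun i => mark (s i)) p} where
  toFun c := ⟨_, hs.closedPath_of_isInvariant hβ c.2⟩
  invFun p := ⟨_, hs.isInvariant_of_closedPath p.2⟩
  left_inv c := Subtype.ext <| funext fun _ =>
    hs.vertical_of_level_eq c.2 rfl (hs.level_midpoint hβ _ _)
  right_inv p := Subtype.ext <| funext fun j => funext fun x =>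
    congrArg (fun l => p.1 l x) (hs.level_midpoint hβ j x)

theorem Ordered.pow_numLoops [Finite V] (hs : Ordered s) (hβ : 0 < β) (n : ℕ) :
    (n + 1) ^ numLoops (PointSet.ofTuple s) =
      Nat.card {p : Fin (k + 1) → V → Fin (n + 1) // ClosedPath (fun i => mark (s i)) p} := by
  -- Finiteness of the set of loops is needed, since `Nat.card` is 0 on infinite types. The same
  -- bijection with values in `Bool` gives it, because indicators of single loops separate loops.
  have : Finite (Loops (PointSet.ofTuple s) → Bool) :=
    Finite.of_equiv _ ((loopsFunEquiv Bool _).trans (hs.invariantEquiv Bool hβ)).symm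
  have : Finite (Loops (PointSet.ofTuple s)) := by
    classical
    refine Finite.of_injective (fun x y => decide (x = y) : _ → Loops (PointSet.ofTuple s) → Bool) ?_
    intro x y h
    simpa using (congrFun h y)
  rw [← Nat.card_congr ((loopsFunEquiv _ _).trans (hs.invariantEquiv _ hβ)), Nat.card_fun, numLoops]
  simp

end Combinatorics

/-! ### Traces of powers as sums over closed paths -/

theorem pow_apply_eq_sum {I R : Type*} [Fintype I] [DecidableEq I] [CommRing R]
    (W : Matrix I I R) (k : ℕ) (a b : I) :
    (W ^ k) a b = ∑ p : Fin k → I,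
      if (Fin.cons a p : Fin (k + 1) → I) (Fin.last k) = b then
        ∏ i : Fin k, W ((Fin.cons a p : Fin (k + 1) → I) i.castSucc) (p i) else 0 := by
  induction k generalizing a with
  | zero => simp [Matrix.one_apply]
  | succ k ih =>
    rw [pow_succ', Matrix.mul_apply, ← (Fin.consEquiv fun _ : Fin (k + 1) => I).sum_comp,
      Fintype.sum_prod_type]
    refine Finset.sum_congr rfl fun c _ => ?_
    rw [ih, Finset.mul_sum]
    refine Finset.sum_congr rfl fun p _ => ?_
    rw [← Fin.succ_last, Fin.cons_succ, mul_ite, mul_zero, Fin.prod_univ_succ]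
    rfl

theorem trace_pow_eq_sum {I R : Type*} [Fintype I] [DecidableEq I] [CommRing R]
    (W : Matrix I I R) (k : ℕ) :
    (W ^ k).trace = ∑ p : Fin (k + 1) → I,
      if p 0 = p (Fin.last k) then ∏ i : Fin k, W (p i.castSucc) (p i.succ) else 0 := by
  rw [← (Fin.consEquiv fun _ : Fin (k + 1) => I).sum_comp, Fintype.sum_prod_type]
  refine Finset.sum_congr rfl fun a _ => ?_
  rw [Matrix.diag_apply, pow_apply_eq_sum]
  refine Finset.sum_congr rfl fun p _ => ?_
  simp [Fin.consEquiv, eq_comm]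

/-! ### Event operators and the expansion of the Hamiltonian -/

instance : Fintype Kind := ⟨⟨{Kind.cross, Kind.bar}, by simp⟩, by rintro (_ | _) <;> simp⟩

theorem sum_kind {M : Type*} [AddCommMonoid M] (f : Kind → M) :
    ∑ K, f K = f Kind.cross + f Kind.bar := by
  change ∑ K ∈ ⟨{Kind.cross, Kind.bar}, _⟩, f K = _
  simp [Finset.sum]

/-- The intensity of the events of each kind. -/
def weight {V : Type*} {G : SimpleGraph V} (u : ℝ) (m : G.edgeSet × Kind) : ℝ :=
  match m.2 with
  | .cross => u
  | .bar => 1 - u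

/-- The number of closed paths of spin configurations compatible with a sequence of events. -/
def numPaths {V : Type*} {G : SimpleGraph V} (n : ℕ) {k : ℕ} (m : Fin k → G.edgeSet × Kind) : ℕ :=
  Nat.card {p : Fin (k + 1) → V → Fin (n + 1) // ClosedPath m p}

section Trace

variable {V : Type*} [Fintype V] [DecidableEq V] {G : SimpleGraph V}

/-- The operator of an event, where the double bars are represented by the pair operator `A`. -/
def markOp {n : ℕ} {A : PairOp n} (hA : A.IsSymm) (m : G.edgeSet × Kind) : SystemOp V n :=
  match m.2 with
  | .cross => edgeOp (pairT n) (pairT_isSymm n) m.1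
  | .bar => edgeOp A hA m.1

open Classical in
theorem markOp_pairQ_apply (n : ℕ) (m : G.edgeSet × Kind) (σ τ : V → Fin (n + 1)) :
    markOp (pairQ_isSymm n) m σ τ = if Compat m σ τ then 1 else 0 := by
  obtain ⟨⟨e, he⟩, K⟩ := m
  induction e using Sym2.ind with
  | _ x y =>
    have h1 : (∀ z, z ≠ x → z ≠ y → σ z = τ z) ↔ ∀ z, z ∉ s(x, y) → σ z = τ z := by
      simp [Sym2.mem_iff, not_or]
    cases K with
    | cross =>
      have h2 : (σ x = τ y ∧ σ y = τ x) ↔ ∀ a b, s(x, y) = s(a, b) → σ a = τ b := by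
        constructor
        · rintro ⟨h, h'⟩ a b hab
          rcases Sym2.eq_iff.1 hab with ⟨rfl, rfl⟩ | ⟨rfl, rfl⟩ <;> assumption
        · exact fun h => ⟨h x y rfl, h y x Sym2.eq_swap⟩
      simp only [markOp, edgeOp, Sym2.lift_mk, extendOp, pairT, Compat, h1, h2, ← ite_and]
      simp
    | bar =>
      have h2 : (σ x = σ y ∧ τ x = τ y) ↔
          ∀ a b, s(x, y) = s(a, b) → σ a = σ b ∧ τ a = τ b := by
        constructor
        · rintro ⟨h, h'⟩ a b hab
          rcases Sym2.eq_iff.1 hab with ⟨rfl, rfl⟩ | ⟨rfl, rfl⟩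
          exacts [⟨h, h'⟩, ⟨h.symm, h'.symm⟩]
        · exact fun h => h x y rfl
      simp only [markOp, edgeOp, Sym2.lift_mk, extendOp, pairQ, Compat, h1, h2, ← ite_and]
      simp

/-- The part `∑ (u T + (1 - u) A)` of the Hamiltonian. -/
def totalOp [Fintype G.edgeSet] {n : ℕ} {A : PairOp n} (hA : A.IsSymm) (u : ℝ) : SystemOp V n :=
  ∑ m : G.edgeSet × Kind, (weight u m : ℂ) • markOp hA m

theorem trace_totalOp_pow [Fintype G.edgeSet] (n : ℕ) (u : ℝ) (k : ℕ) :
    ((totalOp (G := G) (pairQ_isSymm n) u) ^ k).trace =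
      ∑ m : Fin k → G.edgeSet × Kind, ((∏ i, weight u (m i) : ℝ) : ℂ) * numPaths n m := by
  classical
  rw [trace_pow_eq_sum]
  have h : ∀ p : Fin (k + 1) → V → Fin (n + 1),
      (if p 0 = p (Fin.last k) then
        ∏ i : Fin k, totalOp (G := G) (pairQ_isSymm n) u (p i.castSucc) (p i.succ) else 0) =
      ∑ m : Fin k → G.edgeSet × Kind,
        ((∏ i, weight u (m i) : ℝ) : ℂ) * if ClosedPath m p then 1 else 0 := by
    intro p
    simp only [totalOp, Matrix.sum_apply, Matrix.smul_apply, markOp_pairQ_apply, smul_eq_mul]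
    -- A product over steps of sums over marks becomes a sum over sequences of marks.
    rw [Finset.prod_univ_sum, Fintype.piFinset_univ]
    by_cases hp : p 0 = p (Fin.last k)
    · rw [if_pos hp]
      refine Finset.sum_congr rfl fun m _ => ?_
      rw [Finset.prod_mul_distrib, Finset.prod_ite_zero]
      simp [ClosedPath, hp]
    · simp [ClosedPath, hp]
  rw [Finset.sum_congr rfl fun p _ => h p, Finset.sum_comm]
  refine Finset.sum_congr rfl fun m _ => ?_
  rw [← Finset.mul_sum, numPaths, Nat.card_eq_fintype_card, Fintype.card_subtype,
    Finset.sum_boole]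

theorem sum_edgeFinset_eq [DecidableRel G.Adj] {n : ℕ} {A : PairOp n} (hA : A.IsSymm) (u : ℝ) :
    -∑ e ∈ G.edgeFinset, ((u : ℂ) • edgeOp (pairT n) (pairT_isSymm n) e +
      ((1 - u : ℝ) : ℂ) • edgeOp A hA e - 1) =
    ((Fintype.card G.edgeSet : ℝ) : ℂ) • (1 : SystemOp V n) - totalOp (G := G) hA u := by
  rw [Finset.sum_sub_distrib, neg_sub, totalOp, Fintype.sum_prod_type]
  simp only [sum_kind, weight, markOp]
  congr 1
  · rw [Finset.sum_const, SimpleGraph.edgeFinset_card, Complex.ofReal_natCast,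
      Nat.cast_smul_eq_nsmul]
  · exact (Finset.sum_set_coe (f := fun e => (u : ℂ) • edgeOp (pairT n) (pairT_isSymm n) e +
      ((1 - u : ℝ) : ℂ) • edgeOp A hA e) G.edgeSet).symm

end Trace

/-! ### The unitary equivalence of the two Hamiltonians for integer spins -/

section Conjugation

open scoped Kronecker

variable {V : Type*} [Fintype V] [DecidableEq V] {n : ℕ}

/-- The tensor product of copies of the same one-site operator. -/
def tensorPow (V : Type*) [Fintype V] (M : Matrix (Fin (n + 1)) (Fin (n + 1)) ℂ) : SystemOp V n :=
  fun σ τ => ∏ z, M (σ z) (τ z)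

theorem tensorPow_one {V : Type*} [Fintype V] :
    tensorPow V (1 : Matrix (Fin (n + 1)) (Fin (n + 1)) ℂ) = 1 := by
  ext σ τ
  by_cases h : σ = τ
  · subst h
    simp [tensorPow]
  · obtain ⟨z, hz⟩ := Function.ne_iff.1 h
    rw [Matrix.one_apply_ne h]
    exact Finset.prod_eq_zero (Finset.mem_univ z) (Matrix.one_apply_ne hz)

theorem tensorPow_mul (M N : Matrix (Fin (n + 1)) (Fin (n + 1)) ℂ) :
    tensorPow V M * tensorPow V N = tensorPow V (M * N) := by
  ext σ τ
  simp only [Matrix.mul_apply, tensorPow, ← Finset.prod_mul_distrib]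
  rw [Finset.prod_univ_sum, Fintype.piFinset_univ]

/-- A configuration that is prescribed off the pair is parametrized by its values at the two sites.
-/
theorem sum_ite_eq_off_pair {C R : Type*} [Fintype C] [DecidableEq C] [AddCommMonoid R] {x y : V}
    (hxy : x ≠ y) (τ : V → C) (f : (V → C) → R) :
    (∑ ρ : V → C, if ∀ z, z ≠ x → z ≠ y → ρ z = τ z then f ρ else 0) =
      ∑ a : C × C, f (Function.update (Function.update τ x a.1) y a.2) := by
  rw [← Finset.sum_filter]
  refine Finset.sum_nbij' (fun ρ => (ρ x, ρ y))
    (fun a => Function.update (Function.update τ x a.1) y a.2) (by simp) ?_ ?_ ?_ ?_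
  · intro a _
    simp +contextual [Function.update_of_ne]
  · intro ρ hρ
    simp only [Finset.mem_filter, Finset.mem_univ, true_and] at hρ
    funext z
    by_cases hy : z = y
    · subst hy; simp
    by_cases hx : z = x
    · subst hx; simp [hy]
    simp [hx, hy, hρ z hx hy]
  · intro a _
    simp [hxy]
  · intro ρ hρ
    simp only [Finset.mem_filter, Finset.mem_univ, true_and] at hρ
    congr 1
    funext z
    by_cases hy : z = y
    · subst hy; simp
    by_cases hx : z = x
    · subst hx; simp [hy]
    simp [hx, hy, hρ z hx hy]

theorem prod_eq_mul_prod_off_pair {R : Type*} [CommMonoid R] {x y : V} (hxy : x ≠ y)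
    (f : V → R) :
    ∏ z, f z = f x * f y * ∏ z ∈ (Finset.univ.erase x).erase y, f z := by
  rw [← Finset.mul_prod_erase _ f (Finset.mem_univ x),
    ← Finset.mul_prod_erase _ f (Finset.mem_erase.2 ⟨hxy.symm, Finset.mem_univ y⟩), mul_assoc]

/-- Off the pair both products carry the same factor $\prod_z M(\sigma_z,\tau_z)$; what remains is
the two-site intertwining relation. -/
theorem tensorPow_mul_extendOp {M : Matrix (Fin (n + 1)) (Fin (n + 1)) ℂ} {A A' : PairOp n}
    (h : (M ⊗ₖ M) * A = A' * (M ⊗ₖ M)) {x y : V} (hxy : x ≠ y) :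
    tensorPow V M * extendOp A x y = extendOp A' x y * tensorPow V M := by
  ext σ τ
  have hσ : ∀ ρ : V → Fin (n + 1), (∀ z, z ≠ x → z ≠ y → σ z = ρ z) ↔
      ∀ z, z ≠ x → z ≠ y → ρ z = σ z := fun ρ => by simp only [eq_comm]
  have h1 := congrFun (congrFun h (σ x, σ y)) (τ x, τ y)
  simp only [Matrix.mul_apply, Matrix.kroneckerMap_apply] at h1
  simp only [Matrix.mul_apply, extendOp, mul_ite, mul_zero, ite_mul, zero_mul, hσ]
  rw [sum_ite_eq_off_pair hxy, sum_ite_eq_off_pair hxy]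
  have h2 : ∀ a : Fin (n + 1) × Fin (n + 1),
      tensorPow V M σ (Function.update (Function.update τ x a.1) y a.2) =
        M (σ x) a.1 * M (σ y) a.2 * ∏ z ∈ (Finset.univ.erase x).erase y, M (σ z) (τ z) := by
    intro a
    rw [tensorPow, prod_eq_mul_prod_off_pair hxy]
    congr 1
    · simp [hxy]
    · refine Finset.prod_congr rfl fun z hz => ?_
      simp only [Finset.mem_erase, Finset.mem_univ, and_true] at hz
      simp [hz.1, hz.2]
  have h3 : ∀ a : Fin (n + 1) × Fin (n + 1),
      tensorPow V M (Function.update (Function.update σ x a.1) y a.2) τ =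
        M a.1 (τ x) * M a.2 (τ y) * ∏ z ∈ (Finset.univ.erase x).erase y, M (σ z) (τ z) := by
    intro a
    rw [tensorPow, prod_eq_mul_prod_off_pair hxy]
    congr 1
    · simp [hxy]
    · refine Finset.prod_congr rfl fun z hz => ?_
      simp only [Finset.mem_erase, Finset.mem_univ, and_true] at hz
      simp [hz.1, hz.2]
  have h4 := congrArg (· * ∏ z ∈ (Finset.univ.erase x).erase y, M (σ z) (τ z)) h1
  simp only [Finset.sum_mul] at h4
  convert h4 using 2 with a _ a _
  · rw [h2]
    simp only [Function.update_self, Function.update_of_ne hxy]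
    ring
  · rw [h3]
    simp only [Function.update_self, Function.update_of_ne hxy]
    ring

/-! ### The singlet form and its square root -/

/-- The symmetric form given by the singlet state. -/
def singlet (n : ℕ) : Matrix (Fin (n + 1)) (Fin (n + 1)) ℂ := fun a b =>
  if b = a.rev then (-1) ^ (a : ℕ) else 0

theorem spinValue_eq_neg_iff (a b : Fin (n + 1)) : spinValue a = -spinValue b ↔ b = a.rev := by
  rw [Fin.ext_iff, Fin.val_rev, spinValue, spinValue]
  have ha := a.isLt
  constructor
  · intro h
    have : ((a : ℕ) + (b : ℕ) : ℚ) = (n : ℚ) := by linarith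
    have : (a : ℕ) + (b : ℕ) = n := by exact_mod_cast this
    omega
  · intro h
    have : (a : ℕ) + (b : ℕ) = n := by omega
    have : ((a : ℕ) + (b : ℕ) : ℚ) = (n : ℚ) := by exact_mod_cast this
    linarith

theorem pairP_apply (a b c d : Fin (n + 1)) :
    pairP n (a, b) (c, d) = singlet n a b * singlet n c d := by
  have h : (-1 : ℂ) ^ ((a : ℤ) - (c : ℤ)) = (-1) ^ (a : ℕ) * (-1) ^ (c : ℕ) := by
    rw [zpow_sub₀ (by norm_num), zpow_natCast, zpow_natCast, div_eq_mul_inv, ← inv_pow]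
    norm_num
  simp only [pairP, singlet, spinValue_eq_neg_iff, h]
  split_ifs <;> simp_all

/-- This is where integer spin enters: `a` and `a.rev` add up to `n = 2S`, so they have the same
parity when `n` is even. -/
theorem neg_one_pow_rev (hn : Even n) (a : Fin (n + 1)) :
    (-1 : ℂ) ^ (a.rev : ℕ) = (-1) ^ (a : ℕ) := by
  apply neg_one_pow_congr
  have h : (a : ℕ) + (a.rev : ℕ) = n := by rw [Fin.val_rev]; omega
  rw [← h, Nat.even_add] at hn
  exact hn.symm

theorem singlet_transpose (hn : Even n) : (singlet n).transpose = singlet n := by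
  ext a b
  have h : a = b.rev ↔ b = a.rev := by rw [← Fin.rev_eq_iff, eq_comm]
  simp only [Matrix.transpose_apply, singlet, h]
  split_ifs with hb
  · rw [hb, neg_one_pow_rev hn]
  · rfl

theorem singlet_mul_self (hn : Even n) : singlet n * singlet n = 1 := by
  ext a b
  rw [Matrix.mul_apply, Finset.sum_eq_single a.rev (fun c _ hc => by simp [singlet, hc]) (by simp)]
  simp only [singlet, Fin.rev_rev, if_true, neg_one_pow_rev hn, mul_ite, mul_zero, ← mul_pow,
    Matrix.one_apply]
  simp [eq_comm]

/-- A symmetric square root of the symmetric form given by the singlet state. -/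
def singletRoot (n : ℕ) : Matrix (Fin (n + 1)) (Fin (n + 1)) ℂ :=
  ((1 + Complex.I) / 2) • (1 : Matrix (Fin (n + 1)) (Fin (n + 1)) ℂ) +
    ((1 - Complex.I) / 2) • singlet n

theorem singletRoot_transpose (hn : Even n) : (singletRoot n).transpose = singletRoot n := by
  simp [singletRoot, Matrix.transpose_add, Matrix.transpose_smul, singlet_transpose hn]

theorem singletRoot_mul_self (hn : Even n) : singletRoot n * singletRoot n = singlet n := by
  -- The singlet form squares to 1. The coefficients are chosen so that the root acts as $1$ on its
  -- eigenvalue $1$ and as $i$ on its eigenvalue $-1$.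
  have h1 : (1 + Complex.I) / 2 * ((1 + Complex.I) / 2) +
      (1 - Complex.I) / 2 * ((1 - Complex.I) / 2) = 0 := by
    linear_combination (1 / 2 : ℂ) * Complex.I_mul_I
  have h2 : (1 + Complex.I) / 2 * ((1 - Complex.I) / 2) = 1 / 2 := by
    linear_combination (-1 / 4 : ℂ) * Complex.I_mul_I
  have h3 : (1 - Complex.I) / 2 * ((1 + Complex.I) / 2) = 1 / 2 := by rw [mul_comm, h2]
  simp only [singletRoot, add_mul, mul_add, smul_mul_smul_comm, one_mul, mul_one,
    singlet_mul_self hn, h2, h3]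
  rw [add_add_add_comm, add_comm (((1 : ℂ) / 2) • singlet n), add_add_add_comm, ← add_smul, h1]
  rw [← add_smul]
  norm_num

theorem singletRoot_mul_singlet (hn : Even n) :
    singletRoot n * (singletRoot n * singlet n) = 1 := by
  rw [← mul_assoc, singletRoot_mul_self hn, singlet_mul_self hn]

theorem kronecker_mul_pairT (M : Matrix (Fin (n + 1)) (Fin (n + 1)) ℂ) :
    (M ⊗ₖ M) * pairT n = pairT n * (M ⊗ₖ M) := by
  ext ⟨a, b⟩ ⟨c, d⟩
  simp only [Matrix.mul_apply, Matrix.kroneckerMap_apply, pairT, Fintype.sum_prod_type, ite_and,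
    mul_ite, ite_mul, mul_one, one_mul, mul_zero, zero_mul]
  simp [mul_comm]

/-- With $s$ the singlet form, $Q$ and $P$ have rank one, built on the forms $1$ and $s$. Since $M$
is symmetric, $M\otimes M$ turns the form $1$ into $M^2=s$ on the left, and on the right turns $s$
into $MsM=s^2=1$. -/
theorem kronecker_mul_pairQ (hn : Even n) :
    (singletRoot n ⊗ₖ singletRoot n) * pairQ n =
      pairP n * (singletRoot n ⊗ₖ singletRoot n) := by
  set M := singletRoot n with hM
  have hsym : ∀ a b, M b a = M a b := fun a b => congrFun (congrFun (singletRoot_transpose hn) a) b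
  ext ⟨a, b⟩ ⟨c, d⟩
  have hl : ((M ⊗ₖ M) * pairQ n) (a, b) (c, d) = singlet n a b * if c = d then 1 else 0 := by
    rw [← singletRoot_mul_self hn, ← hM]
    simp only [Matrix.mul_apply, Matrix.kroneckerMap_apply, pairQ, Fintype.sum_prod_type, ite_and,
      mul_ite, mul_one, mul_zero]
    simp [hsym b]
  have hr : (pairP n * (M ⊗ₖ M)) (a, b) (c, d) =
      singlet n a b * (M * singlet n * M) c d := by
    simp only [Matrix.mul_apply, Matrix.kroneckerMap_apply, pairP_apply, Fintype.sum_prod_type,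
      Finset.sum_mul, Finset.mul_sum]
    rw [Finset.sum_comm]
    refine Finset.sum_congr rfl fun x _ => Finset.sum_congr rfl fun y _ => ?_
    rw [hsym c y]
    ring
  rw [hl, hr, ← singletRoot_mul_self hn, ← hM, ← mul_assoc M, mul_assoc (M * M), hM,
    singletRoot_mul_self hn, singlet_mul_self hn, Matrix.one_apply]

theorem trace_exp_conj {I : Type*} [Fintype I] [DecidableEq I] {U U' A B : Matrix I I ℂ}
    (hU : U * U' = 1) (h : U * A = B * U) :
    (NormedSpace.exp B).trace = (NormedSpace.exp A).trace := by
  have hu : IsUnit U := IsUnit.of_mul_eq_one U' hU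
  have hU' : U * U⁻¹ = 1 := Matrix.mul_nonsing_inv U ((Matrix.isUnit_iff_isUnit_det U).1 hu)
  have hB : B = U * A * U⁻¹ := by rw [h, mul_assoc, hU', mul_one]
  rw [hB, Matrix.exp_conj U A hu, Matrix.trace_mul_comm, ← mul_assoc,
    Matrix.nonsing_inv_mul U ((Matrix.isUnit_iff_isUnit_det U).1 hu), one_mul]

theorem tensorPow_mul_edgeOp {M : Matrix (Fin (n + 1)) (Fin (n + 1)) ℂ} {A A' : PairOp n}
    (hA : A.IsSymm) (hA' : A'.IsSymm) (h : (M ⊗ₖ M) * A = A' * (M ⊗ₖ M)) {e : Sym2 V}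
    (he : ¬ e.IsDiag) :
    tensorPow V M * edgeOp A hA e = edgeOp A' hA' e * tensorPow V M := by
  induction e using Sym2.ind with
  | _ x y => exact tensorPow_mul_extendOp h he

theorem quantumPartition_hamiltonianTilde (G : SimpleGraph V) [DecidableRel G.Adj] (β : ℝ) (u : ℝ)
    (hn : Even n) :
    quantumPartition β (hamiltonianTilde G n u) = quantumPartition β (hamiltonian G n u) := by
  refine trace_exp_conj (U := tensorPow V (singletRoot n))
    (U' := tensorPow V (singletRoot n * singlet n)) ?_ ?_
  · rw [tensorPow_mul, singletRoot_mul_singlet hn, tensorPow_one]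
  · rw [hamiltonian, hamiltonianTilde, smul_neg, smul_neg, neg_neg, neg_neg, mul_smul_comm,
      smul_mul_assoc, Finset.mul_sum, Finset.sum_mul]
    congr 1
    refine Finset.sum_congr rfl fun e he => ?_
    have hd : ¬ e.IsDiag := G.not_isDiag_of_mem_edgeSet (SimpleGraph.mem_edgeFinset.1 he)
    simp only [mul_sub, sub_mul, mul_add, add_mul, mul_smul_comm, smul_mul_assoc, mul_one, one_mul]
    rw [tensorPow_mul_edgeOp _ (pairT_isSymm n) (kronecker_mul_pairT _) hd,
      tensorPow_mul_edgeOp _ (pairP_isSymm n) (kronecker_mul_pairQ hn) hd]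

end Conjugation

/-! ### Laws of point processes -/

section PointProcess

variable {X : Type*} [MeasurableSpace X] {k : ℕ}

theorem measurable_ofTuple : Measurable (PointSet.ofTuple (X := X) (k := k)) :=
  fun _ hs => MeasurableSpace.measurableSet_iInf.1 hs k

/-- A tuple has the same set of points as some member of `A` iff a reindexing of it lies in `A` and
hits all its entries. There are finitely many reindexings, and equality of coordinates is
measurable. -/
theorem measurableSet_image_ofTuple [MeasurableEq X] {A : Set (Fin k → X)} (hA : MeasurableSet A) :
    MeasurableSet (PointSet.ofTuple '' A) := by
  change MeasurableSet[⨅ m : ℕ, MeasurableSpace.map (PointSet.ofTuple (X := X) (k := m))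
    MeasurableSpace.pi] _
  rw [MeasurableSpace.measurableSet_iInf]
  intro m
  change MeasurableSet ((PointSet.ofTuple (X := X) (k := m)) ⁻¹' _)
  have h : (PointSet.ofTuple (X := X) (k := m)) ⁻¹' (PointSet.ofTuple '' A) =
      ⋃ ι : Fin k → Fin m, {t | t ∘ ι ∈ A} ∩ ⋂ i : Fin m, ⋃ j : Fin k, {t | t i = t (ι j)} := by
    ext t
    simp only [Set.mem_preimage, Set.mem_image, Set.mem_iUnion, Set.mem_inter_iff,
      Set.mem_ofPred_eq, Set.mem_iInter]
    constructor
    · rintro ⟨s, hs, hst⟩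
      have hmem : ∀ x, (∃ j, s j = x) ↔ ∃ i, t i = x := fun x => by
        rw [← mem_ofTuple, ← mem_ofTuple, hst]
      choose ι hι using fun j => (hmem (s j)).1 ⟨j, rfl⟩
      refine ⟨ι, by rwa [show t ∘ ι = s from funext hι], fun i => ?_⟩
      obtain ⟨j, hj⟩ := (hmem (t i)).2 ⟨i, rfl⟩
      exact ⟨j, by rw [hι, hj]⟩
    · rintro ⟨ι, hι, h⟩
      refine ⟨_, hι, ?_⟩
      simp only [PointSet.ofTuple, PointSet.mk.injEq]
      ext x
      simp only [Finset.mem_image, Finset.mem_univ, true_and, Function.comp_apply]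
      constructor
      · rintro ⟨j, rfl⟩
        exact ⟨_, rfl⟩
      · rintro ⟨i, rfl⟩
        obtain ⟨j, hj⟩ := h i
        exact ⟨j, hj.symm⟩
  rw [h]
  refine MeasurableSet.iUnion fun ι => MeasurableSet.inter ?_ <| MeasurableSet.iInter fun i =>
    MeasurableSet.iUnion fun j =>
      measurableSet_eq_fun (measurable_pi_apply _) (measurable_pi_apply _)
  exact (measurable_pi_lambda _ fun j => measurable_pi_apply (ι j)) hA

/-- This lets measurability of the loop count be checked on tuples. On a conull `A` the composite
equals a measurable `g`; cutting `f` off outside `T '' A` makes its preimages images of sets `A ∩ g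
⁻¹' S`, up to the complement of `T '' A`. -/
theorem _root_.AEMeasurable.of_comp_of_image {Y Z : Type*} [MeasurableSpace Y] [MeasurableSpace Z]
    {μ : Measure Y} {T : Y → Z} (hT : Measurable T)
    (hT' : ∀ A, MeasurableSet A → MeasurableSet (T '' A)) {f : Z → ℝ}
    (hf : AEMeasurable (f ∘ T) μ) : AEMeasurable f (μ.map T) := by
  obtain ⟨g, hg, hfg⟩ := hf
  obtain ⟨A, hA, hAm, hAμ⟩ := Filter.Eventually.exists_measurable_mem hfg
  refine ⟨(T '' A).indicator f, fun S hS => ?_, ?_⟩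
  · have h : (T '' A).indicator f ⁻¹' S =
        T '' (A ∩ g ⁻¹' S) ∪ ((T '' A)ᶜ ∩ {_z | (0 : ℝ) ∈ S}) := by
      ext z
      by_cases hz : z ∈ T '' A
      · simp only [Set.mem_preimage, Set.indicator_of_mem hz, Set.mem_union, Set.mem_inter_iff,
          Set.mem_compl_iff, hz, not_true, false_and, or_false]
        constructor
        · obtain ⟨y, hy, rfl⟩ := hz
          exact fun h => ⟨y, ⟨hy, by rw [Set.mem_preimage, ← hAμ y hy]; exact h⟩, rfl⟩
        · rintro ⟨y, ⟨hy, hyS⟩, rfl⟩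
          rw [Set.mem_preimage, ← hAμ y hy] at hyS
          exact hyS
      · have hz' : z ∉ T '' (A ∩ g ⁻¹' S) :=
          fun h => hz (Set.image_mono Set.inter_subset_left h)
        simp [hz, hz']
    rw [h]
    exact (hT' _ (hAm.inter (hg hS))).union ((hT' A hAm).compl.inter (MeasurableSet.const _))
  · filter_upwards [(mem_ae_map_iff hT.aemeasurable (hT' A hAm)).2
      (Filter.mem_of_superset hA (Set.subset_preimage_image T A))] with z hz
    rw [Set.indicator_of_mem hz]

/-- By Fubini, two given coordinates coincide with probability zero, because the measure has no
atoms. -/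
theorem ae_injective {T : Type*} [MeasurableSpace T] [MeasurableEq T] (μ : Measure T)
    [SigmaFinite μ] [NullSingletonClass μ] (k : ℕ) :
    ∀ᵐ t ∂(Measure.pi fun _ : Fin k => μ), Function.Injective t := by
  have h : ∀ i j : Fin k, i ≠ j → ∀ᵐ t ∂(Measure.pi fun _ : Fin k => μ), t i ≠ t j := by
    intro i j hij
    obtain _ | k := k
    · exact i.elim0
    obtain ⟨j, rfl⟩ := Fin.exists_succAbove_eq hij.symm
    have hp := measurePreserving_piFinSuccAbove (fun _ : Fin (k + 1) => μ) i
    have hm : MeasurableSet {a : T × (Fin k → T) | a.1 = a.2 j} :=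
      measurableSet_eq_fun measurable_fst ((measurable_pi_apply j).comp measurable_snd)
    have h0 : (μ.prod (Measure.pi fun _ : Fin k => μ)) {a : T × (Fin k → T) | a.1 = a.2 j} = 0 := by
      rw [Measure.measure_prod_null hm]
      refine Filter.Eventually.of_forall fun x => ?_
      simpa only [Pi.zero_apply, Set.preimage_ofPred_eq, eq_comm] using
        Measure.pi_hyperplane (fun _ : Fin k => μ) j x
    have h1 := hp.quasiMeasurePreserving.preimage_null h0
    filter_upwards [measure_eq_zero_iff_ae_notMem.1 h1] with t ht
    exact ht
  have h' : ∀ᵐ t ∂(Measure.pi fun _ : Fin k => μ), ∀ i j : Fin k, i ≠ j → t i ≠ t j :=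
    ae_all_iff.2 fun i => ae_all_iff.2 fun j => by
      by_cases hij : i = j
      · simp [hij]
      · simpa [hij] using h i j hij
  filter_upwards [h'] with t ht i j hij
  by_contra hne
  exact ht i j hne hij

theorem measurableSet_sort_eq {T : Type*} [MeasurableSpace T] [LinearOrder T] [TopologicalSpace T]
    [OrderClosedTopology T] [SecondCountableTopology T] [OpensMeasurableSpace T]
    (σ : Equiv.Perm (Fin k)) :
    MeasurableSet {t : Fin k → T | Tuple.sort t = σ} := by
  simp only [eq_comm (b := σ), Tuple.eq_sort_iff, Monotone, Function.comp_apply]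
  measurability

end PointProcess

/-! ### Integrals with respect to the intensity -/

section Intensity

instance : DiscreteMeasurableSpace Kind := ⟨fun _ => trivial⟩

instance {V : Type*} (G : SimpleGraph V) : DiscreteMeasurableSpace G.edgeSet := ⟨fun _ => trivial⟩

/-- The intensities of the two kinds of events. -/
def kindMeasure (u : ℝ) : Measure Kind :=
  ENNReal.ofReal u • Measure.dirac Kind.cross + ENNReal.ofReal (1 - u) • Measure.dirac Kind.bar

instance (u : ℝ) : IsFiniteMeasure (kindMeasure u) := ⟨by simp [kindMeasure]⟩

/-- The Lebesgue measure on `[0, β]`. -/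
def timeMeasure (β : ℝ) : Measure (Set.Icc (0 : ℝ) β) := Measure.comap Subtype.val volume

theorem timeMeasure_apply (β : ℝ) (s : Set (Set.Icc (0 : ℝ) β)) :
    timeMeasure β s = volume (Subtype.val '' s) :=
  (MeasurableEmbedding.subtype_coe measurableSet_Icc).comap_apply _ _

theorem timeMeasure_univ (β : ℝ) : timeMeasure β Set.univ = ENNReal.ofReal β := by
  rw [timeMeasure_apply, Set.image_univ, Subtype.range_coe, Real.volume_Icc, sub_zero]

instance (β : ℝ) : IsFiniteMeasure (timeMeasure β) := ⟨by simp [timeMeasure_univ]⟩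

instance (β : ℝ) : NullSingletonClass (timeMeasure β) := ⟨fun x => by simp [timeMeasure_apply]⟩

variable {V : Type*} (G : SimpleGraph V) {β u : ℝ} {k : ℕ}

/-- The intensity of the events, without their times. -/
def markMeasure {V : Type*} (G : SimpleGraph V) (u : ℝ) : Measure (G.edgeSet × Kind) :=
  Measure.count.prod (kindMeasure u)

instance [Finite V] : IsFiniteMeasure (markMeasure G u) := by unfold markMeasure; infer_instance

theorem markMeasure_singleton [Finite V] (hu : u ∈ Set.Icc (0 : ℝ) 1) (m : G.edgeSet × Kind) :
    (markMeasure G u).real {m} = weight u m := by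
  obtain ⟨e, K⟩ := m
  rw [measureReal_def, markMeasure, ← Set.singleton_prod_singleton, Measure.prod_prod]
  cases K <;> simp [kindMeasure, weight, hu.1, hu.2]

theorem measurePreserving_mark_time [Finite V] (β u : ℝ) :
    MeasurePreserving (fun l : Link G β => (mark l, l.2.1)) (intensity G β u)
      ((markMeasure G u).prod (timeMeasure β)) :=
  (measurePreserving_prodAssoc Measure.count (kindMeasure u) (timeMeasure β)).symm.comp
    ((MeasurePreserving.id Measure.count).prod
      (Measure.measurePreserving_swap (μ := timeMeasure β) (ν := kindMeasure u)))

instance [Finite V] : IsFiniteMeasure (intensity G β u) := by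
  change IsFiniteMeasure (Measure.count.prod ((timeMeasure β).prod (kindMeasure u)))
  infer_instance

theorem measurePreserving_marks_times [Finite V] (β u : ℝ) (k : ℕ) :
    MeasurePreserving
      (fun t : Fin k → Link G β => ((fun i => mark (t i), fun i => (t i).2.1) :
        (Fin k → G.edgeSet × Kind) × (Fin k → Set.Icc (0 : ℝ) β)))
      (Measure.pi fun _ => intensity G β u)
      ((Measure.pi fun _ => markMeasure G u).prod (Measure.pi fun _ => timeMeasure β)) :=
  (measurePreserving_arrowProdEquivProdArrow _ _ (Fin k) (fun _ => markMeasure G u)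
    (fun _ => timeMeasure β)).comp
    (measurePreserving_pi _ _ fun _ => measurePreserving_mark_time G β u)

theorem ae_time_mem_Ioo (β : ℝ) :
    ∀ᵐ r : Set.Icc (0 : ℝ) β ∂(timeMeasure β), (0 : ℝ) < r ∧ (r : ℝ) < β := by
  have h : ∀ c : ℝ, ∀ᵐ r : Set.Icc (0 : ℝ) β ∂(timeMeasure β), (r : ℝ) ≠ c := by
    intro c
    rw [ae_iff, timeMeasure_apply]
    refine measure_mono_null ?_ (measure_singleton (μ := volume) c)
    rintro _ ⟨r, hr, rfl⟩
    simpa using hr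
  filter_upwards [h 0, h β] with r h0 h1
  exact ⟨lt_of_le_of_ne r.2.1 h0.symm, lt_of_le_of_ne r.2.2 h1⟩

/-! ### Sorting the events by time -/

/-- The number of closed paths for given events, which are put in the order of their times. -/
def sortedPaths {V : Type*} {G : SimpleGraph V} (n : ℕ)
    (a : (Fin k → G.edgeSet × Kind) × (Fin k → Set.Icc (0 : ℝ) β)) : ℕ :=
  numPaths n (a.1 ∘ Tuple.sort a.2)

/-- For each of the finitely many mark sequences, the times matter only through their sorting
permutation. -/
theorem measurable_sortedPaths [Finite V] (n : ℕ) :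
    Measurable (sortedPaths (G := G) (k := k) (β := β) n) := by
  refine measurable_from_prod_countable_right fun m => ?_
  have h : Measurable[_, ⊤] fun τ : Fin k → Set.Icc (0 : ℝ) β => Tuple.sort τ :=
    @measurable_to_countable' _ _ ⊤ _ _ _ fun σ => measurableSet_sort_eq σ
  exact (measurable_from_top (f := fun σ : Equiv.Perm (Fin k) => numPaths n (m ∘ σ))).comp h

theorem integrable_sortedPaths [Finite V] (n : ℕ) :
    Integrable (fun a => (sortedPaths (G := G) (k := k) (β := β) n a : ℝ))
      ((Measure.pi fun _ => markMeasure G u).prod (Measure.pi fun _ => timeMeasure β)) := by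
  obtain ⟨B, hB⟩ := (Set.finite_range (numPaths (G := G) (k := k) n)).bddAbove
  refine Integrable.of_bound (C := B)
    (measurable_from_top.comp (measurable_sortedPaths G n)).aestronglyMeasurable ?_
  refine Filter.Eventually.of_forall fun a => ?_
  rw [Real.norm_natCast, Nat.cast_le]
  exact hB ⟨_, rfl⟩

theorem integral_sortedPaths [Finite V] [Fintype G.edgeSet] (hβ : 0 ≤ β) (hu : u ∈ Set.Icc (0 : ℝ) 1)
    (n : ℕ) :
    ∫ a, (sortedPaths (G := G) (k := k) (β := β) n a : ℝ)
      ∂((Measure.pi fun _ => markMeasure G u).prod (Measure.pi fun _ => timeMeasure β)) =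
    β ^ k * ∑ m : Fin k → G.edgeSet × Kind, (∏ i, weight u (m i)) * numPaths n m := by
  rw [integral_prod_symm _ (integrable_sortedPaths G n)]
  have h : ∀ τ : Fin k → Set.Icc (0 : ℝ) β,
      ∫ m, (sortedPaths (G := G) n (m, τ) : ℝ) ∂(Measure.pi fun _ => markMeasure G u) =
        ∑ m : Fin k → G.edgeSet × Kind, (∏ i, weight u (m i)) * numPaths n m := by
    intro τ
    rw [integral_fintype (.of_finite)]
    -- For fixed times, sorting is a bijection of mark sequences that preserves the product of
    -- weights, so the result no longer depends on the times.
    refine (Finset.sum_congr rfl fun m _ => ?_).trans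
      (Equiv.sum_comp (Equiv.arrowCongr (Tuple.sort τ).symm (Equiv.refl (G.edgeSet × Kind)))
        fun m => (∏ i, weight u (m i)) * (numPaths n m : ℝ))
    rw [show (Equiv.arrowCongr (Tuple.sort τ).symm (Equiv.refl (G.edgeSet × Kind))) m =
        m ∘ Tuple.sort τ from rfl, smul_eq_mul, measureReal_def, Measure.pi_singleton,
      ENNReal.toReal_prod]
    congr 1
    simp only [← measureReal_def, markMeasure_singleton G hu, Function.comp_apply]
    exact (Equiv.prod_comp (Tuple.sort τ) fun i => weight u (m i)).symm
  simp only [h, integral_const, smul_eq_mul]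
  congr 1
  rw [measureReal_def, Measure.pi_univ]
  simp [timeMeasure_univ, hβ]

theorem ordered_comp_sort {t : Fin k → Link G β} (hinj : Function.Injective fun i => (t i).2.1)
    (ht : ∀ i, 0 < time (t i) ∧ time (t i) < β) :
    Ordered (t ∘ Tuple.sort fun i => (t i).2.1) where
  mono := (Tuple.monotone_sort fun i => (t i).2.1).strictMono_of_injective
    (hinj.comp (Equiv.injective _))
  pos _ := (ht _).1
  lt _ := (ht _).2

theorem ae_pow_numLoops_eq [Finite V] (hβ : 0 < β) (n : ℕ) :
    ∀ᵐ t ∂(Measure.pi fun _ : Fin k => intensity G β u),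
      ((n : ℝ) + 1) ^ numLoops (PointSet.ofTuple t) =
        sortedPaths (G := G) n (fun i => mark (t i), fun i => (t i).2.1) := by
  have h1 : ∀ᵐ a ∂((Measure.pi fun _ : Fin k => markMeasure G u).prod
      (Measure.pi fun _ : Fin k => timeMeasure β)),
      Function.Injective a.2 ∧ ∀ i, (0 : ℝ) < a.2 i ∧ (a.2 i : ℝ) < β := by
    refine Measure.quasiMeasurePreserving_snd.ae
      (p := fun τ : Fin k → Set.Icc (0 : ℝ) β => Function.Injective τ ∧
        ∀ i, (0 : ℝ) < τ i ∧ (τ i : ℝ) < β) ?_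
    refine (ae_injective _ k).and (ae_all_iff.2 fun i => ?_)
    exact (Measure.tendsto_eval_ae_ae (μ := fun _ : Fin k => timeMeasure β) (i := i)).eventually
      (ae_time_mem_Ioo β)
  filter_upwards [(measurePreserving_marks_times G β u k).quasiMeasurePreserving.ae h1] with t ht
  have hs := ordered_comp_sort G ht.1 ht.2
  rw [← ofTuple_comp_perm t (Tuple.sort fun i => (t i).2.1)]
  exact_mod_cast hs.pow_numLoops hβ n

theorem integrable_pow_numLoops [Finite V] (hβ : 0 < β) (n k : ℕ) :
    Integrable (fun ω => ((n : ℝ) + 1) ^ numLoops ω)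
      (Measure.map (PointSet.ofTuple (k := k)) (Measure.pi fun _ => intensity G β u)) := by
  have h := ((measurePreserving_marks_times G β u k).integrable_comp_of_integrable
    (integrable_sortedPaths G n)).congr ((ae_pow_numLoops_eq G hβ n).mono fun _ => Eq.symm)
  have hm := AEMeasurable.of_comp_of_image (f := fun ω : Config G β => ((n : ℝ) + 1) ^ numLoops ω)
    measurable_ofTuple
    (fun A hA => measurableSet_image_ofTuple hA) h.aemeasurable
  exact (integrable_map_measure hm.aestronglyMeasurable measurable_ofTuple.aemeasurable).2 h

theorem integral_pow_numLoops [Finite V] [Fintype G.edgeSet] (hβ : 0 < β) (hu : u ∈ Set.Icc (0 : ℝ) 1)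
    (n k : ℕ) :
    ∫ ω, ((n : ℝ) + 1) ^ numLoops ω
      ∂(Measure.map (PointSet.ofTuple (k := k)) (Measure.pi fun _ => intensity G β u)) =
    β ^ k * ∑ m : Fin k → G.edgeSet × Kind, (∏ i, weight u (m i)) * numPaths n m := by
  rw [integral_map measurable_ofTuple.aemeasurable
    (integrable_pow_numLoops G hβ n k).aestronglyMeasurable,
    integral_congr_ae (ae_pow_numLoops_eq G hβ n), ← integral_sortedPaths G hβ.le hu n,
    ← (measurePreserving_marks_times G β u k).map_eq, integral_map]
  · exact (measurePreserving_marks_times G β u k).measurable.aemeasurable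
  · exact (measurable_from_top.comp (measurable_sortedPaths G n)).aestronglyMeasurable

theorem intensity_univ [Finite V] [Fintype G.edgeSet] (hβ : 0 ≤ β) (hu : u ∈ Set.Icc (0 : ℝ) 1) :
    (intensity G β u).real Set.univ = Fintype.card G.edgeSet * β := by
  change (Measure.count.prod ((timeMeasure β).prod (kindMeasure u))).real Set.univ = _
  rw [measureReal_def, ← Set.univ_prod_univ, Measure.prod_prod, ← Set.univ_prod_univ,
    Measure.prod_prod, timeMeasure_univ]
  -- The intensities $u$ and $1-u$ add up to one, which is why the Poisson normalization matches the
  -- shift by $-1$ on each edge.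
  have : kindMeasure u Set.univ = 1 := by
    simp [kindMeasure, ← ENNReal.ofReal_add hu.1 (sub_nonneg.2 hu.2)]
  have hc : Measure.count (Set.univ : Set G.edgeSet) = Fintype.card G.edgeSet := by
    rw [Measure.count_univ, ENat.card_eq_coe_fintype_card]
    rfl
  rw [this, hc, mul_one, ENNReal.toReal_mul, ENNReal.toReal_natCast, ENNReal.toReal_ofReal hβ]

end Intensity

/-! ### The loop representation -/

theorem hasSum_trace_exp {I : Type*} [Fintype I] [DecidableEq I] (A : Matrix I I ℂ) (z : ℂ) :
    HasSum (fun k : ℕ => z ^ k / (k.factorial : ℂ) * (A ^ k).trace)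
      (NormedSpace.exp (z • A)).trace := by
  let _ : NormedRing (Matrix I I ℂ) := Matrix.linftyOpNormedRing
  let _ : NormedAlgebra ℂ (Matrix I I ℂ) := Matrix.linftyOpNormedAlgebra
  have h := (NormedSpace.exp_series_hasSum_exp' (𝕂 := ℂ) (z • A)).map
    (Matrix.traceAddMonoidHom I ℂ) (continuous_id.matrix_trace)
  convert! h using 2 with k
  simp only [Function.comp_apply, Matrix.traceAddMonoidHom_apply, smul_pow, Matrix.trace_smul,
    smul_eq_mul]
  ring

theorem exp_smul_one_add {I : Type*} [Fintype I] [DecidableEq I] (A : Matrix I I ℂ) (z : ℂ) :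
    NormedSpace.exp (z • (1 : Matrix I I ℂ) + A) = Complex.exp z • NormedSpace.exp A := by
  let _ : NormedRing (Matrix I I ℂ) := Matrix.linftyOpNormedRing
  let _ : NormedAlgebra ℂ (Matrix I I ℂ) := Matrix.linftyOpNormedAlgebra
  have h : NormedSpace.exp (z • (1 : Matrix I I ℂ)) = Complex.exp z • 1 := by
    rw [← Algebra.algebraMap_eq_smul_one, ← Algebra.algebraMap_eq_smul_one, Complex.exp_eq_exp_ℂ]
    exact (NormedSpace.algebraMap_exp_comm (𝔸 := Matrix I I ℂ) z).symm
  rw [Matrix.exp_add_of_commute _ _ ((Commute.one_left A).smul_left z), h, smul_mul_assoc, one_mul]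

theorem quantumPartition_hamiltonian {V : Type*} [Fintype V] [DecidableEq V] (G : SimpleGraph V)
    [DecidableRel G.Adj] (β u : ℝ) (n : ℕ) :
    quantumPartition β (hamiltonian G n u) =
      ((Real.exp (-(Fintype.card G.edgeSet * β)) : ℝ) : ℂ) *
        (NormedSpace.exp ((β : ℂ) • totalOp (G := G) (pairQ_isSymm n) u)).trace := by
  have h : -((β : ℂ) • hamiltonian G n u) =
      (-(Fintype.card G.edgeSet * β) : ℂ) • (1 : SystemOp V n) +
        (β : ℂ) • totalOp (G := G) (pairQ_isSymm n) u := by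
    rw [hamiltonian, sum_edgeFinset_eq, smul_sub, smul_smul, neg_sub, neg_smul, mul_comm,
      Complex.ofReal_natCast, neg_add_eq_sub]
  rw [quantumPartition, h, exp_smul_one_add, Matrix.trace_smul, smul_eq_mul]
  push_cast
  rfl

theorem integrable_and_integral_rho {V : Type*} [Fintype V] [DecidableEq V] (G : SimpleGraph V)
    [DecidableRel G.Adj] {β : ℝ} (hβ : 0 < β) {u : ℝ} (hu : u ∈ Set.Icc (0 : ℝ) 1) (n : ℕ) :
    Integrable (fun ω => ((n : ℝ) + 1) ^ numLoops ω) (rho G β u) ∧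
      ((∫ ω, ((n : ℝ) + 1) ^ numLoops ω ∂(rho G β u) : ℝ) : ℂ) =
        quantumPartition β (hamiltonian G n u) := by
  set c : ℝ := Fintype.card G.edgeSet * β with hc
  set f : Config G β → ℝ := fun ω => ((n : ℝ) + 1) ^ numLoops ω with hf
  set μ : ℕ → Measure (Config G β) := fun k =>
    ENNReal.ofReal (Real.exp (-(intensity G β u).real Set.univ) / (k.factorial : ℝ)) •
      Measure.map (PointSet.ofTuple (k := k)) (Measure.pi fun _ => intensity G β u) with hμ
  have hrho : rho G β u = Measure.sum μ := rfl
  have hfk : ∀ k, Integrable f (μ k) := fun k =>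
    (integrable_pow_numLoops G hβ n k).smul_measure ENNReal.ofReal_ne_top
  have hnorm : ∀ ω, ‖f ω‖ = f ω := fun ω => Real.norm_of_nonneg (by positivity)
  have hint : ∀ k, ((∫ ω, f ω ∂(μ k) : ℝ) : ℂ) = (Real.exp (-c) : ℂ) *
      ((β : ℂ) ^ k / (k.factorial : ℂ) *
        ((totalOp (G := G) (pairQ_isSymm n) u) ^ k).trace) := by
    intro k
    rw [hμ, integral_smul_measure, intensity_univ G hβ.le hu, ← hc,
      ENNReal.toReal_ofReal (by positivity), hf, integral_pow_numLoops G hβ hu, trace_totalOp_pow, smul_eq_mul]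
    push_cast
    ring
  have hsum := (hasSum_trace_exp (totalOp (G := G) (pairQ_isSymm n) u) (β : ℂ)).mul_left
    (Real.exp (-c) : ℂ)
  rw [← quantumPartition_hamiltonian] at hsum
  simp only [← hint] at hsum
  have hi : Integrable f (rho G β u) := by
    rw [hrho]
    refine integrable_sum_measure hfk ?_
    simp only [hnorm]
    -- The integrand is nonnegative, so the convergent trace series itself supplies the summability
    -- of the norms.
    exact Complex.summable_ofReal.1 hsum.summable
  refine ⟨hi, ?_⟩
  rw [hrho] at hi ⊢
  exact (Complex.hasSum_ofReal.2 (hasSum_integral_measure hi)).unique hsum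

end RandomLoops

end

/-- Loop representation of the partition functions, for spin `S = n / 2` (so `n + 1 = 2 S + 1`). -/
theorem mainTheorem7 {V : Type*} [Fintype V] [DecidableEq V] (G : SimpleGraph V)
    [DecidableRel G.Adj] (β : ℝ) (hβ : 0 < β) (u : ℝ) (hu : u ∈ Set.Icc (0 : ℝ) 1) (n : ℕ) :
    MeasureTheory.Integrable
        (fun ω => ((n : ℝ) + 1) ^ RandomLoops.numLoops ω) (RandomLoops.rho G β u) ∧
      ((∫ ω, ((n : ℝ) + 1) ^ RandomLoops.numLoops ω ∂(RandomLoops.rho G β u) : ℝ) : ℂ) =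
        RandomLoops.quantumPartition β (RandomLoops.hamiltonian G n u) ∧
      (Even n →
        ((∫ ω, ((n : ℝ) + 1) ^ RandomLoops.numLoops ω ∂(RandomLoops.rho G β u) : ℝ) : ℂ) =
          RandomLoops.quantumPartition β (RandomLoops.hamiltonianTilde G n u)) := by
  obtain ⟨h1, h2⟩ := RandomLoops.integrable_and_integral_rho G hβ hu n
  exact ⟨h1, h2, fun hn => h2.trans (RandomLoops.quantumPartition_hamiltonianTilde G β u hn).symm⟩
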